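/- Let $S$ be a closed, densely defined symmetric operator in a separable complex Hilbert space $\mathcal H$. For a unit vector $\phi\in\mathrm{Dom}(S)$ put $\Delta S[\phi]=\sqrt{\langle S\phi,S\phi\rangle-\langle S\phi,\phi\rangle^2}$; for $t\in\mathbb R$ put $$\Delta S_t=\inf\{\Delta S[\phi] : \phi\in\mathrm{Dom}(S),\ \|\phi\|=1,\ \langle S\phi,\phi\rangle=t\}\in[0,\infty],\qquad \Delta S=\inf_{t\in\mathbb R}\Delta S_t ,$$ where $\inf\emptyset=+\infty$; the same notation is used for other operators. Let $\mathfrak S$ be the set of all self-adjoint extensions of $S$ within $\mathcal H$. Suppose that $S$ has equal deficiency indices $(n,n)$, $n=\dim\ker(S^*-i)=\dim\ker(S^*+i)\in\{0,1,2,\dots,\infty\}$, and that $\Delta S>0$. (1) For every $t\in\mathbb R$ there is an $S'\in\mathfrak S$ with $\Delta S'_t\ge \Delta S/\sqrt2$; in particular $\sup_{S'\in\mathfrak S}\Delta S'_t\ge\Delta S/\sqrt2$. (2) If $n=1$, then for every $t\in\mathbb R$ there is an $S'\in\mathfrak S$ with $\Delta S'_t\ge\Delta S$, and $$\Delta S=\inf_{t\in\mathbb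 R}\ \sup_{S'\in\mathfrak S}\Delta S'_t=\inf_{t\in\mathbb R}\ \max_{S'\in\mathfrak S}\ \min_{\lambda,\mu\in\sigma(S')}\sqrt{|\lambda-t|\,|\mu-t|},$$ where the last minimum and maximum are attained. Moreover $\Delta S=\inf_{t\in\mathbb R}\sup_{S'\in\mathfrak S}\inf\{\sqrt{|\lambda-t|\,|\mu-t|}:\lambda,\mu\in\sigma(S'),\ \lambda\ne\mu\}$. -/

import Mathlib

open scoped ENNReal

namespace LinearPMap

noncomputable section

variable {H : Type*} [NormedAddCommGroup H] [InnerProductSpace ℂ H]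

/-- The expectation value `⟨φ, S φ⟩` of `S` at a vector `φ` of its domain. For a symmetric `S` the
inner product is a real number, so nothing is lost by taking its real part. -/
def expectation (S : H →ₗ.[ℂ] H) (φ : S.domain) : ℝ :=
  (inner ℂ (φ : H) (S φ)).re

/-- The uncertainty `√(⟨S φ, S φ⟩ - ⟨S φ, φ⟩ ^ 2)` of `S` at a unit vector `φ` of its domain. -/
def uncertainty (S : H →ₗ.[ℂ] H) (φ : S.domain) : ℝ :=
  √((inner ℂ (S φ) (S φ)).re - S.expectation φ ^ 2)

/-- The minimum uncertainty of `S` at `t`: the infimum of the uncertainty over the unit vectors of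
the domain with expectation value `t`, as an element of `[0, ∞]` (it is `∞` if there is no such
vector). -/
def minUncertaintyAt (S : H →ₗ.[ℂ] H) (t : ℝ) : ℝ≥0∞ :=
  ⨅ (φ : S.domain) (_ : ‖(φ : H)‖ = 1) (_ : S.expectation φ = t),
    ENNReal.ofReal (S.uncertainty φ)

/-- The overall lower bound on the uncertainty of `S`. -/
def minUncertainty (S : H →ₗ.[ℂ] H) : ℝ≥0∞ :=
  ⨅ t : ℝ, S.minUncertaintyAt t

/-- The eigenspace `ker (T - z)` of a partially defined operator `T`, as a subspace of `H`. -/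
def eigenspaceAt (T : H →ₗ.[ℂ] H) (z : ℂ) : Submodule ℂ H where
  carrier := {x | ∃ hx : x ∈ T.domain, T ⟨x, hx⟩ = z • x}
  zero_mem' := ⟨T.domain.zero_mem, by
    rw [smul_zero]; exact T.map_zero⟩
  add_mem' := by
    rintro x y ⟨hx, hx'⟩ ⟨hy, hy'⟩
    refine ⟨T.domain.add_mem hx hy, ?_⟩
    rw [smul_add, ← hx', ← hy']
    exact T.map_add ⟨x, hx⟩ ⟨y, hy⟩
  smul_mem' := by
    rintro c x ⟨hx, hx'⟩
    refine ⟨T.domain.smul_mem c hx, ?_⟩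
    rw [smul_comm, ← hx']
    exact T.map_smul c ⟨x, hx⟩

/-- The dimension in `{0, 1, 2, …, ∞}` of `ker (S† - z)`. -/
def deficiencyIndex [CompleteSpace H] (S : H →ₗ.[ℂ] H) (z : ℂ) : ℕ∞ :=
  Cardinal.toENat (Module.rank ℂ (eigenspaceAt S.adjoint z))

/-- `S` has deficiency indices `(p, q)`, where `p = dim ker (S† - i)`, `q = dim ker (S† + i)`. -/
def HasDeficiencyIndices [CompleteSpace H] (S : H →ₗ.[ℂ] H) (p q : ℕ∞) : Prop :=
  S.deficiencyIndex Complex.I = p ∧ S.deficiencyIndex (-Complex.I) = q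

/-- The spectrum of `T`: all complex `z` such that `T - z` has no bounded inverse defined on all
of `H`. -/
def opSpectrum (T : H →ₗ.[ℂ] H) : Set ℂ :=
  {z | ¬ ∃ R : H →L[ℂ] H,
      (∀ x : H, ∃ hx : R x ∈ T.domain, T ⟨R x, hx⟩ - z • R x = x) ∧
      (∀ φ : T.domain, R (T φ - z • (φ : H)) = φ)}

/-- The set of all self-adjoint extensions of `S` within `H`. -/
def selfAdjointExtensions [CompleteSpace H] (S : H →ₗ.[ℂ] H) : Set (H →ₗ.[ℂ] H) :=
  {T | S ≤ T ∧ IsSelfAdjoint T}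

/-- The infimum of `√(|l - t| |m - t|)` over all `l, m` in the spectrum of `T`. -/
def spectralMin (T : H →ₗ.[ℂ] H) (t : ℝ) : ℝ≥0∞ :=
  ⨅ (l ∈ T.opSpectrum) (m ∈ T.opSpectrum), ENNReal.ofReal √(‖l - t‖ * ‖m - t‖)

/-- The infimum of `√(|l - t| |m - t|)` over all `l ≠ m` in the spectrum of `T`. -/
def spectralMinDistinct (T : H →ₗ.[ℂ] H) (t : ℝ) : ℝ≥0∞ :=
  ⨅ (l ∈ T.opSpectrum) (m ∈ T.opSpectrum) (_ : l ≠ m), ENNReal.ofReal √(‖l - t‖ * ‖m - t‖)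

end

end LinearPMap

/-! ### Extending symmetric contractions -/

namespace ContinuousLinearMap

variable {H : Type*} [NormedAddCommGroup H] [InnerProductSpace ℂ H] [CompleteSpace H]

/-! Write `u` for the uncertainty at a unit vector `φ`. Then `‖(S - t) φ‖²` is `u²` plus the squared
distance from `t` to the mean, so `ΔS ≥ c` gives `‖(S - t) φ‖ ≥ c ‖φ‖` for every real `t`. Krein's
theorem (`exists_selfAdjointExtension_isResolventAt`) yields a self-adjoint extension `T` with `‖(T
- t)⁻¹‖ ≤ c⁻¹`. At mean `t` the uncertainty of `T` is `‖(T - t) φ‖ ≥ c`, and the spectrum of `T`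
stays at distance `c` from `t`. This holds for all deficiency indices, without the factor `√2`.

Conversely, no extension exceeds `ΔS_t`. For the uncertainty this is restriction to fewer vectors.
For the spectral quantities let `B = (T - t)⁻¹` have spectrum in `[a, b]` with endpoints attained,
and apply `(B - a)(b - B) ≥ 0` to `ψ = (T - t) φ`. Mean `t` says `⟨ψ, B ψ⟩ = 0`, leaving `1 ≤ -a b
u²`, that is `u² ≥ |l - t| |m - t|` with `l = t + 1/a`, `m = t + 1/b`
(`spectralMinDistinct_le_uncertainty`). The infimum over `t` gives the minimax formulas. -/

/-- Douglas factorization for a majorized operator: if `‖C x‖ ≤ ‖D x‖` for all `x` then `C = K D`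
for a contraction `K`, whose range is contained in the closure of the range of `C`. -/
theorem exists_contraction_mul_eq (C D : H →L[ℂ] H) (h : ∀ x, ‖C x‖ ≤ ‖D x‖) :
    ∃ K : H →L[ℂ] H, ‖K‖ ≤ 1 ∧ K * D = C ∧ ∀ L : H →L[ℂ] H, L * C = 0 → L * K = 0 := by
  set M := (LinearMap.range D.toLinearMap).topologicalClosure with hM
  have : CompleteSpace M :=
    (Submodule.isClosed_topologicalClosure _).completeSpace_coe
  have hmem : ∀ x, D x ∈ M := fun x => Submodule.le_topologicalClosure _ ⟨x, rfl⟩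
  let e : H →ₗ[ℂ] M := D.toLinearMap.codRestrict M hmem
  have he : DenseRange e := by
    intro y
    rw [Metric.mem_closure_iff]
    intro ε hε
    obtain ⟨z, ⟨x, rfl⟩, hz⟩ := Metric.mem_closure_iff.1 y.2 ε hε
    exact ⟨e x, ⟨x, rfl⟩, hz⟩
  have hle : ∀ x, ‖C.toLinearMap x‖ ≤ 1 * ‖e x‖ := fun x => by
    rw [one_mul]; exact h x
  -- The majorization makes `D x ↦ C x` well defined and contractive on the range of `D`; it extends
  -- to the closure `M`, and by zero to `Mᗮ`.
  let E : M →L[ℂ] H := C.toLinearMap.extendOfNorm e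
  have hE : ∀ x, E (e x) = C x := fun x => LinearMap.extendOfNorm_eq he ⟨1, hle⟩ x
  refine ⟨E ∘L M.orthogonalProjectionOnto, ?_, ?_, ?_⟩
  · refine opNorm_le_bound _ zero_le_one fun x => ?_
    calc ‖E (M.orthogonalProjectionOnto x)‖ ≤ 1 * ‖M.orthogonalProjectionOnto x‖ :=
          LinearMap.norm_extendOfNorm_apply_le he 1 hle _
      _ ≤ 1 * ‖x‖ := by
          gcongr
          exact M.norm_orthogonalProjectionOnto_apply_le x
  · ext x
    have : M.orthogonalProjectionOnto (D x) = e x :=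
      M.orthogonalProjectionOnto_mem_subspace_eq_self (e x)
    change E (M.orthogonalProjectionOnto (D x)) = C x
    rw [this, hE]
  · intro L hL
    have h0 : ∀ y : M, L (E y) = 0 := by
      intro y
      refine he.induction_on (p := fun y => L (E y) = 0) y ?_ ?_
      · exact isClosed_eq (by fun_prop) continuous_const
      · intro x
        rw [hE]
        exact DFunLike.congr_fun hL x
    ext x
    exact h0 _

/-- The defect operator `√(1 - A²)` of a self-adjoint contraction `A`. -/
theorem exists_defect_operator (A : H →L[ℂ] H) (hA : IsSelfAdjoint A) (hA1 : ‖A‖ ≤ 1) :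
    ∃ D : H →L[ℂ] H, IsSelfAdjoint D ∧ Commute A D ∧ D * D = 1 - A * A := by
  refine ⟨cfc (fun x : ℝ => √(1 - x * x)) A, cfc_predicate _ _, ?_, ?_⟩
  · have h := cfc_commute_cfc (id : ℝ → ℝ) (fun x : ℝ => √(1 - x * x)) A
    rwa [cfc_id ℝ A hA] at h
  · rw [← cfc_mul (fun x : ℝ => √(1 - x * x)) (fun x : ℝ => √(1 - x * x)) A]
    have : 1 - A * A = cfc (fun x : ℝ => 1 - x * x) A := by
      rw [cfc_sub (fun _ : ℝ => (1 : ℝ)) (fun x : ℝ => x * x) A, cfc_const_one ℝ A,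
        cfc_mul (fun x : ℝ => x) (fun x : ℝ => x) A, cfc_id' ℝ A]
    rw [this]
    refine cfc_congr fun x hx => ?_
    have hx1 : |x| ≤ 1 := by
      calc ‖x‖ ≤ ‖A‖ * ‖(1 : H →L[ℂ] H)‖ := spectrum.norm_le_norm_mul_of_mem hx
        _ ≤ 1 * 1 := by gcongr; exact norm_id_le
        _ = 1 := one_mul 1
    refine Real.mul_self_sqrt ?_
    nlinarith [abs_le.1 hx1]

/-- Krein's extension theorem for contractions: if `P` is an orthogonal projection and `G` is a
contraction on the range of `P` that is symmetric there, then `G` extends to a self-adjoint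
contraction. -/
theorem exists_selfAdjoint_contraction_extension (P G : H →L[ℂ] H) (hP : IsSelfAdjoint P)
    (hPP : P * P = P) (hGP : G * P = G) (hG : ‖G‖ ≤ 1) (hPG : IsSelfAdjoint (P * G)) :
    ∃ B : H →L[ℂ] H, IsSelfAdjoint B ∧ ‖B‖ ≤ 1 ∧ B * P = G := by
  have pyth : ∀ x : H, ‖P x‖ ^ 2 + ‖x - P x‖ ^ 2 = ‖x‖ ^ 2 := by
    intro x
    have h0 : inner ℂ (P x) (x - P x) = 0 := by
      have : inner ℂ (P x) (x - P x) = inner ℂ x (P (x - P x)) := by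
        rw [← adjoint_inner_left, hP.adjoint_eq]
      rw [this, map_sub, show P (P x) = P x from DFunLike.congr_fun hPP x, sub_self,
        inner_zero_right]
    have := norm_add_sq_eq_norm_sq_add_norm_sq_of_inner_eq_zero (P x) (x - P x) h0
    rw [add_sub_cancel] at this
    nlinarith
  have hP1 : ∀ x, ‖P x‖ ≤ ‖x‖ := fun x => by
    refine le_of_sq_le_sq ?_ (norm_nonneg _)
    nlinarith [pyth x, sq_nonneg ‖x - P x‖]
  have hG1 : ∀ x, ‖G x‖ ≤ ‖x‖ := fun x => by
    simpa using G.le_of_opNorm_le hG x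
  set A := P * G with hAdef
  have hAP : A * P = A := by rw [hAdef, mul_assoc, hGP]
  have hPA : P * A = A := by rw [hAdef, ← mul_assoc, hPP]
  have hA1 : ‖A‖ ≤ 1 := opNorm_le_bound _ zero_le_one fun x => by
    rw [one_mul]; exact (hP1 _).trans (hG1 x)
  obtain ⟨D, hD, hAD, hDD⟩ := exists_defect_operator A hPG hA1
  set C := (1 - P) * G with hCdef
  have hCP : C * P = C := by rw [hCdef, mul_assoc, hGP]
  have hPC : P * C = 0 := by rw [hCdef, ← mul_assoc, mul_sub, mul_one, hPP, sub_self, zero_mul]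
  have symA : ∀ x y, inner ℂ (A x) y = inner ℂ x (A y) := fun x y => by
    rw [← adjoint_inner_right, hPG.adjoint_eq]
  have symD : ∀ x y, inner ℂ (D x) y = inner ℂ x (D y) := fun x y => by
    rw [← adjoint_inner_right, hD.adjoint_eq]
  have normD : ∀ x, ‖A x‖ ^ 2 + ‖D x‖ ^ 2 = ‖x‖ ^ 2 := fun x => by
    have h1 : inner ℂ (D x) (D x) = inner ℂ x x - inner ℂ (A x) (A x) := by
      rw [symD, symA, ← inner_sub_right]
      exact congrArg _ (DFunLike.congr_fun hDD x)
    simp only [inner_self_eq_norm_sq_to_K] at h1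
    have h2 : ‖D x‖ ^ 2 = ‖x‖ ^ 2 - ‖A x‖ ^ 2 := by exact_mod_cast h1
    linarith
  -- Compare `‖A x‖² + ‖C x‖² = ‖G x‖² ≤ ‖x‖²` with `‖A x‖² + ‖D x‖² = ‖x‖²`.
  have hCD : ∀ x, ‖C x‖ ≤ ‖D x‖ := fun x => by
    have h1 := pyth (G x)
    have h2 := normD x
    have h3 : ‖G x‖ ^ 2 ≤ ‖x‖ ^ 2 := by gcongr; exact hG1 x
    refine le_of_sq_le_sq ?_ (norm_nonneg _)
    change ‖G x - P (G x)‖ ^ 2 ≤ _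
    change ‖P (G x)‖ ^ 2 + _ = _ at h2
    linarith
  obtain ⟨K, hK1, hKD, hKL⟩ := exists_contraction_mul_eq C D hCD
  have hPK : P * K = 0 := hKL P hPC
  have hKP : star K * P = 0 := by
    have := congrArg star hPK
    rwa [star_mul, hP.star_eq, star_zero] at this
  have hDK : D * star K = star C := by rw [← hKD, star_mul, hD.star_eq]
  have hPDK : P * (D * star K) = D * star K := by
    rw [hDK]
    have := congrArg star hCP
    rwa [star_mul, hP.star_eq] at this
  -- The rotation `[[A, D], [D, -A]]` is isometric because `A` and `D` commute. Multiplying by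
  -- `diag(1, K)` on the left and `diag(1, K*)` on the right keeps it a self-adjoint contraction and
  -- makes its first column `(A, K D) = (A, C)`, which is `G`.
  refine ⟨A + D * star K + K * D - K * A * star K, ?_, ?_, ?_⟩
  · rw [IsSelfAdjoint]
    simp only [star_add, star_sub, star_mul, star_star, hPG.star_eq, hD.star_eq]
    noncomm_ring
  · refine opNorm_le_bound _ zero_le_one fun x => ?_
    rw [one_mul]
    set q := star K x with hq
    set p := P x with hp
    have hAp : A p = A x := DFunLike.congr_fun hAP x
    have hKDp : K (D p) = K (D x) := by
      change (K * D * P) x = (K * D) x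
      rw [hKD, hCP]
    have hB : (A + D * star K + K * D - K * A * star K) x
        = (A p + D q) + K (D p - A q) := by
      simp only [add_apply, sub_apply, map_sub, hKDp, hAp]
      abel
    have hPu : P (A p + D q) = A p + D q := by
      rw [map_add]
      exact congrArg₂ _ (DFunLike.congr_fun hPA p) (DFunLike.congr_fun hPDK x)
    have horth : inner ℂ (A p + D q) (K (D p - A q)) = 0 := by
      rw [← hPu, ← adjoint_inner_right, hP.adjoint_eq,
        show P (K (D p - A q)) = 0 from DFunLike.congr_fun hPK _, inner_zero_right]
    have h1 := norm_add_sq_eq_norm_sq_add_norm_sq_of_inner_eq_zero _ _ horth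
    have h2 : ‖K (D p - A q)‖ ≤ ‖D p - A q‖ := by simpa using K.le_of_opNorm_le hK1 (D p - A q)
    have hcross : RCLike.re (inner ℂ (A p) (D q)) = RCLike.re (inner ℂ (D p) (A q)) := by
      rw [symA, symD, show A (D q) = D (A q) from DFunLike.congr_fun hAD q]
    have h3 : ‖A p + D q‖ ^ 2 + ‖D p - A q‖ ^ 2 = ‖p‖ ^ 2 + ‖q‖ ^ 2 := by
      rw [@norm_add_sq ℂ, @norm_sub_sq ℂ, hcross, ← normD p, ← normD q]
      ring
    have hq1 : ‖q‖ ≤ ‖x - p‖ := by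
      have : q = star K (x - p) := by
        rw [map_sub, show star K p = 0 from DFunLike.congr_fun hKP x, sub_zero]
      rw [this]
      have hK1' : ‖star K‖ ≤ 1 := by rwa [norm_star]
      simpa using (star K).le_of_opNorm_le hK1' (x - p)
    have h4 := pyth x
    refine le_of_sq_le_sq ?_ (norm_nonneg _)
    rw [hB, sq, h1, ← sq, ← sq]
    have h5 : ‖K (D p - A q)‖ ^ 2 ≤ ‖D p - A q‖ ^ 2 := by gcongr
    have h6 : ‖q‖ ^ 2 ≤ ‖x - p‖ ^ 2 := by gcongr
    linarith
  · rw [sub_mul, add_mul, add_mul, hAP, mul_assoc D, hKP, mul_zero, mul_assoc (K * A), hKP,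
      mul_zero, hKD, hCP, hAdef, hCdef]
    noncomm_ring

end ContinuousLinearMap

/-! ### Resolvents and spectra -/

namespace LinearPMap

variable {H : Type*} [NormedAddCommGroup H] [InnerProductSpace ℂ H]

/-- `R` is the resolvent of `T` at `z`, the bounded inverse of `T - z`. -/
def IsResolventAt (T : H →ₗ.[ℂ] H) (z : ℂ) (R : H →L[ℂ] H) : Prop :=
  (∀ x : H, ∃ hx : R x ∈ T.domain, T ⟨R x, hx⟩ - z • R x = x) ∧
    (∀ φ : T.domain, R (T φ - z • (φ : H)) = φ)

theorem mem_opSpectrum_iff {T : H →ₗ.[ℂ] H} {z : ℂ} :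
    z ∈ T.opSpectrum ↔ ¬ ∃ R, T.IsResolventAt z R := Iff.rfl

namespace IsResolventAt

variable {T : H →ₗ.[ℂ] H} {z w : ℂ} {B : H →L[ℂ] H}

theorem mem_domain (h : T.IsResolventAt w B) (x : H) : B x ∈ T.domain := (h.1 x).1

theorem apply_resolvent (h : T.IsResolventAt w B) (x : H) :
    T ⟨B x, h.mem_domain x⟩ = x + w • B x := by
  obtain ⟨_, h2⟩ := h.1 x
  rw [← sub_eq_iff_eq_add]; exact h2

theorem resolvent_apply (h : T.IsResolventAt w B) (φ : T.domain) :
    B (T φ) = φ + w • B φ := by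
  have := h.2 φ
  rw [_root_.map_sub, _root_.map_smul] at this
  exact sub_eq_iff_eq_add.1 this

theorem injective (h : T.IsResolventAt w B) : Function.Injective B := by
  rw [injective_iff_map_eq_zero]
  intro x hx
  have h1 := h.apply_resolvent x
  have h2 : (⟨B x, h.mem_domain x⟩ : T.domain) = 0 := Subtype.ext hx
  rw [h2, hx, smul_zero, add_zero, T.map_zero] at h1
  exact h1.symm

theorem norm_le (h : T.IsResolventAt w B) (φ : T.domain) :
    ‖(φ : H)‖ ≤ ‖B‖ * ‖T φ - w • (φ : H)‖ := by
  conv_lhs => rw [← h.2 φ]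
  exact B.le_opNorm _

/-- The points of the spectrum of `T` other than `w` correspond to those of the resolvent. -/
theorem mem_opSpectrum_iff_mem_spectrum (h : T.IsResolventAt w B) (hz : z ≠ w) :
    z ∈ T.opSpectrum ↔ (z - w)⁻¹ ∈ spectrum ℂ B := by
  have hzw : z - w ≠ 0 := sub_ne_zero.2 hz
  rw [mem_opSpectrum_iff, spectrum.mem_iff, not_iff_not]
  have key : algebraMap ℂ (H →L[ℂ] H) (z - w)⁻¹ - B = (z - w)⁻¹ • (1 - (z - w) • B) := by
    rw [smul_sub, smul_smul, inv_mul_cancel₀ hzw, one_smul, Algebra.algebraMap_eq_smul_one]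
  have key2 : IsUnit (algebraMap ℂ (H →L[ℂ] H) (z - w)⁻¹ - B) ↔ IsUnit (1 - (z - w) • B) := by
    rw [key]
    exact isUnit_smul_iff (Units.mk0 _ (inv_ne_zero hzw)) _
  rw [key2]
  constructor
  · rintro ⟨R, hR⟩
    -- The resolvent identity in both orders shows that `1 + (z - w) R` inverts `1 - (z - w) B`.
    have h1 : ∀ x, R x - B x = (z - w) • B (R x) := by
      intro x
      have e1 := h.2 ⟨R x, hR.mem_domain x⟩
      rw [hR.apply_resolvent x] at e1
      simp only [_root_.map_sub, _root_.map_add, _root_.map_smul] at e1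
      rw [sub_smul, ← sub_eq_zero, ← sub_eq_zero.2 e1.symm]
      abel
    have h2 : ∀ x, R x - B x = (z - w) • R (B x) := by
      intro x
      have e1 := hR.2 ⟨B x, h.mem_domain x⟩
      rw [h.apply_resolvent x] at e1
      simp only [_root_.map_sub, _root_.map_add, _root_.map_smul] at e1
      rw [sub_smul, ← sub_eq_zero, ← sub_eq_zero.2 e1]
      abel
    refine ⟨⟨1 - (z - w) • B, 1 + (z - w) • R, ?_, ?_⟩, rfl⟩
    · ext x
      change (x + (z - w) • R x) - (z - w) • B (x + (z - w) • R x) = x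
      rw [_root_.map_add, _root_.map_smul, ← h1 x, _root_.smul_add, smul_sub]
      abel
    · ext x
      change (x - (z - w) • B x) + (z - w) • R (x - (z - w) • B x) = x
      rw [_root_.map_sub, _root_.map_smul, ← h2 x, smul_sub, smul_sub]
      abel
  · intro hu
    obtain ⟨V, hV1, hV2⟩ := isUnit_iff_exists.1 hu
    set A := 1 - (z - w) • B with hA
    have hAx : ∀ x, A x = x - (z • B x - w • B x) := fun x => by
      rw [← sub_smul]; rfl
    have hc : A * B = B * A := by
      simp only [hA, sub_mul, mul_sub, one_mul, mul_one, smul_mul_assoc, mul_smul_comm]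
    have hc' : V * B = B * V := by
      calc V * B = V * (B * A) * V := by rw [mul_assoc, mul_assoc, hV1, mul_one]
        _ = B * V := by rw [← hc, ← mul_assoc, hV2, one_mul]
    have e2 : ∀ x, A (V x) = x := DFunLike.congr_fun hV1
    have e3 : ∀ x, V (A x) = x := DFunLike.congr_fun hV2
    -- This is the resolvent identity solved for the resolvent at `z`.
    refine ⟨B * V, fun x => ⟨h.mem_domain _, ?_⟩, fun φ => ?_⟩
    · refine Eq.trans ?_ (e2 x)
      change T ⟨B (V x), _⟩ - z • B (V x) = _
      rw [h.apply_resolvent (V x), hAx]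
      abel
    · rw [← hc']
      refine Eq.trans ?_ (e3 φ)
      change V (B _) = _
      congr 1
      rw [_root_.map_sub, _root_.map_smul, h.resolvent_apply φ, hAx]
      abel

/-- The spectrum of `B` lies in the disc of radius `‖B‖`, and `z ↦ (z - w)⁻¹` turns this disc into
the exterior of one around `w`. -/
theorem le_norm_sub [CompleteSpace H] (h : T.IsResolventAt w B) {c : ℝ} (hc : 0 < c)
    (hBc : ‖B‖ ≤ c⁻¹) (hz : z ∈ T.opSpectrum) : c ≤ ‖z - w‖ := by
  have hzw : z ≠ w := by
    rintro rfl
    exact hz ⟨B, h⟩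
  have hB := (h.mem_opSpectrum_iff_mem_spectrum hzw).1 hz
  have h1 : ‖z - w‖⁻¹ ≤ c⁻¹ := by
    calc ‖z - w‖⁻¹ = ‖(z - w)⁻¹‖ := (norm_inv _).symm
      _ ≤ ‖B‖ * ‖(1 : H →L[ℂ] H)‖ := spectrum.norm_le_norm_mul_of_mem hB
      _ ≤ ‖B‖ * 1 := by gcongr; exact ContinuousLinearMap.norm_id_le
      _ ≤ c⁻¹ := by rwa [mul_one]
  exact (inv_le_inv₀ (norm_pos_iff.2 (sub_ne_zero.2 hzw)) hc).1 h1

theorem isSelfAdjoint [CompleteSpace H] {t : ℝ} (h : T.IsResolventAt t B)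
    (hT : T.IsFormalAdjoint T) : IsSelfAdjoint B := by
  rw [ContinuousLinearMap.isSelfAdjoint_iff_isSymmetric]
  intro x y
  have h1 := hT ⟨B x, h.mem_domain x⟩ ⟨B y, h.mem_domain y⟩
  rw [h.apply_resolvent, h.apply_resolvent] at h1
  simp only [inner_add_left, inner_add_right, inner_smul_left, inner_smul_right,
    Complex.conj_ofReal, add_left_inj] at h1
  exact h1.symm

/-- The point of the spectrum of a self-adjoint operator that is closest to `w`. -/
theorem exists_mem_opSpectrum_norm_sub_eq [CompleteSpace H] [Nontrivial H]
    (h : T.IsResolventAt w B) (hB : IsSelfAdjoint B) :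
    ∃ l ∈ T.opSpectrum, ‖l - w‖ = ‖B‖⁻¹ := by
  have hB0 : B ≠ 0 := by
    rintro rfl
    obtain ⟨x, hx⟩ := exists_ne (0 : H)
    exact hx (h.injective rfl)
  -- For self-adjoint `B` the spectral radius is the norm, so a spectral value of maximal modulus
  -- inverts to the nearest point.
  obtain ⟨k, hk, hk'⟩ := spectrum.exists_nnnorm_eq_spectralRadius B
  rw [hB.spectralRadius_eq_nnnorm, ENNReal.coe_inj] at hk'
  have hk'' : ‖k‖ = ‖B‖ := congrArg NNReal.toReal hk'
  have hk0 : k ≠ 0 := by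
    rw [← norm_ne_zero_iff, hk'']
    exact norm_ne_zero_iff.2 hB0
  refine ⟨w + k⁻¹, ?_, by rw [add_sub_cancel_left, norm_inv, hk'']⟩
  rw [h.mem_opSpectrum_iff_mem_spectrum (by simpa using hk0)]
  simpa using hk

end IsResolventAt

/-! ### Self-adjoint extensions preserving a spectral gap -/

variable [CompleteSpace H]

theorem isFormalAdjoint_of_isSelfAdjoint {T : H →ₗ.[ℂ] H} (hT : IsSelfAdjoint T) :
    T.IsFormalAdjoint T := by
  have h := adjoint_isFormalAdjoint hT.dense_domain
  rwa [isSelfAdjoint_def.1 hT] at h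

/-- An injective bounded self-adjoint operator is the resolvent at `t` of a self-adjoint
operator. -/
theorem exists_isSelfAdjoint_isResolventAt (B : H →L[ℂ] H) (hB : IsSelfAdjoint B)
    (hinj : Function.Injective B) (t : ℝ) :
    ∃ T : H →ₗ.[ℂ] H, IsSelfAdjoint T ∧ T.IsResolventAt t B := by
  let e := LinearEquiv.ofInjective B.toLinearMap hinj
  let T : H →ₗ.[ℂ] H :=
    { domain := LinearMap.range B.toLinearMap
      toFun := e.symm.toLinearMap + (t : ℂ) • (LinearMap.range B.toLinearMap).subtype }
  have hsymm : ∀ x y, inner ℂ (B x) y = inner ℂ x (B y) := fun x y => by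
    rw [← ContinuousLinearMap.adjoint_inner_right, hB.adjoint_eq]
  have hmem : ∀ x, B x ∈ T.domain := fun x => ⟨x, rfl⟩
  have hT : ∀ x, T ⟨B x, hmem x⟩ = x + (t : ℂ) • B x := fun x =>
    congrArg (· + (t : ℂ) • B x) (e.symm_apply_apply x)
  have hsurj : ∀ φ : T.domain, ∃ x, φ = ⟨B x, hmem x⟩ := by
    rintro ⟨_, x, rfl⟩
    exact ⟨x, rfl⟩
  have hR : T.IsResolventAt t B := by
    refine ⟨fun x => ⟨hmem x, by rw [hT, add_sub_cancel_right]⟩, fun φ => ?_⟩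
    obtain ⟨x, rfl⟩ := hsurj φ
    rw [hT, add_sub_cancel_right]
  have hdense : Dense (T.domain : Set H) := by
    rw [Submodule.dense_iff_topologicalClosure_eq_top, Submodule.topologicalClosure_eq_top_iff,
      Submodule.eq_bot_iff]
    intro x hx
    refine hinj ?_
    rw [_root_.map_zero, ← inner_self_eq_zero (𝕜 := ℂ), hsymm]
    exact (Submodule.mem_orthogonal' _ _).1 hx _ (hmem _)
  have hTT : T.IsFormalAdjoint T := by
    intro φ ψ
    obtain ⟨x, rfl⟩ := hsurj φ
    obtain ⟨y, rfl⟩ := hsurj ψ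
    rw [hT, hT]
    simp only [inner_add_left, inner_add_right, inner_smul_left, inner_smul_right,
      Complex.conj_ofReal]
    rw [hsymm x y]
  refine ⟨T, ?_, hR⟩
  rw [isSelfAdjoint_def]
  refine (eq_of_le_of_domain_eq (hTT.le_adjoint hdense) ?_).symm
  refine le_antisymm (hTT.le_adjoint hdense).1 fun y hy => ?_
  set v := T.adjoint ⟨y, hy⟩ - (t : ℂ) • y with hv
  -- Pairing with arbitrary `u` identifies `y` with `B (T† - t) y`, so the adjoint has no larger
  -- domain than the range of `B`.
  suffices y = B v by rw [this]; exact hmem v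
  refine ext_inner_right ℂ fun u => ?_
  have h1 := adjoint_isFormalAdjoint hdense ⟨y, hy⟩ ⟨B u, hmem u⟩
  rw [hT] at h1
  rw [hsymm, hv, inner_sub_left, h1]
  simp only [inner_add_right, inner_smul_left, inner_smul_right, Complex.conj_ofReal,
    add_sub_cancel_right]

/-- Krein's extension theorem for symmetric operators with a spectral gap: if `S - t` is bounded
from below by `c` then `S` has a self-adjoint extension whose resolvent at `t` is bounded by
`c⁻¹`. -/
theorem exists_selfAdjointExtension_isResolventAt {S : H →ₗ.[ℂ] H}
    (hdense : Dense (S.domain : Set H)) (hsymm : S.IsFormalAdjoint S) (t : ℝ) {c : ℝ} (hc : 0 < c)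
    (h : ∀ φ : S.domain, c * ‖(φ : H)‖ ≤ ‖S φ - (t : ℂ) • (φ : H)‖) :
    ∃ T ∈ S.selfAdjointExtensions, ∃ B : H →L[ℂ] H,
      T.IsResolventAt t B ∧ IsSelfAdjoint B ∧ ‖B‖ ≤ c⁻¹ := by
  let f : S.domain →ₗ[ℂ] H := S.toFun - (t : ℂ) • S.domain.subtype
  have hf : ∀ φ : S.domain, f φ = S φ - (t : ℂ) • (φ : H) := fun _ => rfl
  set M := (LinearMap.range f).topologicalClosure with hM
  have : CompleteSpace M := (Submodule.isClosed_topologicalClosure _).completeSpace_coe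
  have hmem : ∀ x, f x ∈ M := fun x => Submodule.le_topologicalClosure _ ⟨x, rfl⟩
  let e : S.domain →ₗ[ℂ] M := f.codRestrict M hmem
  have he : DenseRange e := by
    intro y
    rw [Metric.mem_closure_iff]
    intro ε hε
    obtain ⟨z, ⟨x, rfl⟩, hz⟩ := Metric.mem_closure_iff.1 y.2 ε hε
    exact ⟨e x, ⟨x, rfl⟩, hz⟩
  -- The factor `c` turns the inverse of `S - t` into a contraction.
  let g : S.domain →ₗ[ℂ] H := (c : ℂ) • S.domain.subtype
  have hle : ∀ x, ‖g x‖ ≤ 1 * ‖e x‖ := fun x => by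
    rw [one_mul]
    change ‖(c : ℂ) • (x : H)‖ ≤ ‖f x‖
    rw [norm_smul, Complex.norm_real, Real.norm_of_nonneg hc.le]
    exact h x
  let E : M →L[ℂ] H := g.extendOfNorm e
  have hE : ∀ x, E (e x) = (c : ℂ) • (x : H) := fun x =>
    LinearMap.extendOfNorm_eq he ⟨1, hle⟩ x
  have hEsymm : ∀ x y : M, inner ℂ (E x) (y : H) = inner ℂ (x : H) (E y) := by
    intro x y
    refine he.induction_on₂ (p := fun x y => inner ℂ (E x) (y : H) = inner ℂ (x : H) (E y))
      ?_ ?_ x y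
    · exact isClosed_eq (by fun_prop) (by fun_prop)
    · intro φ ψ
      rw [hE, hE]
      change inner ℂ ((c : ℂ) • (φ : H)) (f ψ) = inner ℂ (f φ) ((c : ℂ) • (ψ : H))
      rw [hf, hf]
      simp only [inner_sub_left, inner_sub_right, inner_smul_left, inner_smul_right,
        Complex.conj_ofReal]
      rw [hsymm φ ψ]
      ring
  let G : H →L[ℂ] H := E ∘L M.orthogonalProjectionOnto
  have hP : IsSelfAdjoint M.starProjection := isSelfAdjoint_starProjection M
  have hPsymm : ∀ x y, inner ℂ (M.starProjection x) y = inner ℂ x (M.starProjection y) :=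
    fun x y => by rw [← ContinuousLinearMap.adjoint_inner_right, hP.adjoint_eq]
  have hGP : G * M.starProjection = G := by
    ext x
    change E (M.orthogonalProjectionOnto (M.starProjection x)) = E _
    congr 1
    exact M.orthogonalProjectionOnto_mem_subspace_eq_self _
  have hG : ‖G‖ ≤ 1 := by
    refine ContinuousLinearMap.opNorm_le_bound _ zero_le_one fun x => ?_
    calc ‖E (M.orthogonalProjectionOnto x)‖ ≤ 1 * ‖M.orthogonalProjectionOnto x‖ :=
          LinearMap.norm_extendOfNorm_apply_le he 1 hle _
      _ ≤ 1 * ‖x‖ := by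
          gcongr
          exact M.norm_orthogonalProjectionOnto_apply_le x
  have hPG : IsSelfAdjoint (M.starProjection * G) := by
    rw [ContinuousLinearMap.isSelfAdjoint_iff_isSymmetric]
    intro x y
    change inner ℂ (M.starProjection (E (M.orthogonalProjectionOnto x))) y =
      inner ℂ x (M.starProjection (E (M.orthogonalProjectionOnto y)))
    exact (hPsymm _ _).trans ((hEsymm (M.orthogonalProjectionOnto x)
      (M.orthogonalProjectionOnto y)).trans (hPsymm _ _))
  obtain ⟨B', hB', hB'1, hB'G⟩ :=
    ContinuousLinearMap.exists_selfAdjoint_contraction_extension M.starProjection G hP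
      M.isIdempotentElem_starProjection hGP hG hPG
  have hB'f : ∀ φ, B' (f φ) = (c : ℂ) • (φ : H) := fun φ => by
    have h1 : M.starProjection (f φ) = f φ := Submodule.starProjection_eq_self_iff.2 (hmem φ)
    have h2 : M.orthogonalProjectionOnto (f φ) = e φ :=
      M.orthogonalProjectionOnto_mem_subspace_eq_self (e φ)
    rw [← hE, ← h2]
    conv_lhs => rw [← h1]
    exact DFunLike.congr_fun hB'G (f φ)
  have hc0 : (c : ℂ) ≠ 0 := by exact_mod_cast hc.ne'
  set B : H →L[ℂ] H := (c⁻¹ : ℝ) • B' with hBdef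
  have hB : IsSelfAdjoint B := (IsSelfAdjoint.all (c⁻¹ : ℝ)).smul hB'
  have hBf : ∀ φ, B (f φ) = φ := fun φ => by
    change (c⁻¹ : ℝ) • B' (f φ) = φ
    rw [hB'f, ← Complex.coe_smul, smul_smul, Complex.ofReal_inv, inv_mul_cancel₀ hc0, one_smul]
  -- The kernel of `B` is orthogonal to its range, which contains the dense domain of `S`.
  have hinj : Function.Injective B := by
    rw [injective_iff_map_eq_zero]
    intro x hx
    refine hdense.eq_zero_of_inner_left ℂ fun φ hφ => ?_
    rw [show φ = B (f ⟨φ, hφ⟩) from (hBf ⟨φ, hφ⟩).symm,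
      ← ContinuousLinearMap.adjoint_inner_left, hB.adjoint_eq, hx, inner_zero_left]
  obtain ⟨T, hT, hR⟩ := exists_isSelfAdjoint_isResolventAt B hB hinj t
  refine ⟨T, ⟨⟨fun φ hφ => ?_, ?_⟩, hT⟩, B, hR, hB, ?_⟩
  · have := hR.mem_domain (f ⟨φ, hφ⟩)
    rwa [hBf] at this
  · intro φ ψ hφψ
    have h1 := hR.apply_resolvent (f φ)
    have h2 : (⟨B (f φ), hR.mem_domain _⟩ : T.domain) = ψ := Subtype.ext ((hBf φ).trans hφψ)
    rw [h2, hBf, hf, sub_add_cancel] at h1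
    exact h1.symm
  · rw [hBdef, norm_smul, norm_inv, Real.norm_of_nonneg hc.le]
    exact mul_le_of_le_one_right (inv_nonneg.2 hc.le) hB'1

end LinearPMap

/-! ### A quadratic inequality from spectral bounds -/

namespace ContinuousLinearMap

variable {H : Type*} [NormedAddCommGroup H] [InnerProductSpace ℂ H] [CompleteSpace H]

/-- If the spectrum of a self-adjoint `B` lies in `[α, β]`, then `(B - α) (β - B) ≥ 0`. -/
theorem norm_sq_le_of_spectrum_subset_Icc {B : H →L[ℂ] H} (hB : IsSelfAdjoint B) {α β : ℝ}
    (h : spectrum ℝ B ⊆ Set.Icc α β) (x : H) :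
    ‖B x‖ ^ 2 ≤ (α + β) * (inner ℂ x (B x)).re - α * β * ‖x‖ ^ 2 := by
  set N := cfc (fun r : ℝ => (r - α) * (β - r)) B with hN
  have hN0 : 0 ≤ N := cfc_nonneg fun r hr =>
    mul_nonneg (sub_nonneg.2 (h hr).1) (sub_nonneg.2 (h hr).2)
  have hNB : N = (B - algebraMap ℝ _ α) * (algebraMap ℝ _ β - B) := by
    rw [hN, cfc_mul (fun r : ℝ => r - α) (fun r : ℝ => β - r) B,
      cfc_sub (fun r : ℝ => r) (fun _ : ℝ => α) B, cfc_sub (fun _ : ℝ => β) (fun r : ℝ => r) B,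
      cfc_id' ℝ B, cfc_const α B, cfc_const β B]
  have h1 : 0 ≤ (inner ℂ x (N x)).re :=
    ((nonneg_iff_isPositive N).1 hN0).re_inner_nonneg_right x
  have h2 : N x = (α + β : ℂ) • B x - B (B x) - (α * β : ℂ) • x := by
    rw [hNB]
    change B (β • x - B x) - α • (β • x - B x) = _
    rw [map_sub, ← Complex.coe_smul, map_smul, ← Complex.coe_smul]
    module
  have h3 : inner ℂ x (B (B x)) = inner ℂ (B x) (B x) := by
    rw [← adjoint_inner_right, hB.adjoint_eq]
  rw [h2, inner_sub_right, inner_sub_right, inner_smul_right, inner_smul_right, h3,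
    inner_self_eq_norm_sq_to_K, inner_self_eq_norm_sq_to_K] at h1
  have h4 : ((α + β : ℂ) * inner ℂ x (B x)).re = (α + β) * (inner ℂ x (B x)).re := by
    rw [← Complex.ofReal_add, Complex.re_ofReal_mul]
  have h5 : (((‖B x‖ : ℂ)) ^ 2).re = ‖B x‖ ^ 2 := by
    rw [← Complex.ofReal_pow, Complex.ofReal_re]
  have h6 : ((α * β : ℂ) * (‖x‖ : ℂ) ^ 2).re = α * β * ‖x‖ ^ 2 := by
    rw [← Complex.ofReal_pow, ← Complex.ofReal_mul, ← Complex.ofReal_mul, Complex.ofReal_re]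
  simp only [Complex.sub_re, Complex.coe_algebraMap] at h1
  rw [h4, h5, h6] at h1
  linarith

end ContinuousLinearMap

/-! ### Uncertainty and the norm of `S - t` -/

namespace LinearPMap

variable {H : Type*} [NormedAddCommGroup H] [InnerProductSpace ℂ H]

theorem norm_apply_sub_smul_sq (S : H →ₗ.[ℂ] H) {φ : S.domain} (hφ : ‖(φ : H)‖ = 1) (t : ℝ) :
    ‖S φ - (t : ℂ) • (φ : H)‖ ^ 2 = ‖S φ‖ ^ 2 - 2 * t * S.expectation φ + t ^ 2 := by
  have h : RCLike.re (inner ℂ (S φ) ((t : ℂ) • (φ : H))) = t * S.expectation φ := by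
    rw [inner_smul_right, expectation]
    exact (Complex.re_ofReal_mul _ _).trans (congrArg _ (inner_re_symm (𝕜 := ℂ) _ _))
  rw [@norm_sub_sq ℂ, h, norm_smul, hφ, Complex.norm_real, mul_one, Real.norm_eq_abs, sq_abs]
  ring

/-- The uncertainty at a unit vector is the norm of `(S - ⟨S⟩) φ`. -/
theorem uncertainty_eq_norm (S : H →ₗ.[ℂ] H) {φ : S.domain} (hφ : ‖(φ : H)‖ = 1) :
    S.uncertainty φ = ‖S φ - (S.expectation φ : ℂ) • (φ : H)‖ := by
  have h := S.norm_apply_sub_smul_sq hφ (S.expectation φ)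
  have h1 : (inner ℂ (S φ) (S φ)).re = ‖S φ‖ ^ 2 := inner_self_eq_norm_sq (𝕜 := ℂ) _
  rw [uncertainty, h1, ← Real.sqrt_sq (norm_nonneg (S φ - _)), h]
  congr 1
  ring

/-- The mean minimizes `t ↦ ‖(S - t) φ‖`. -/
theorem uncertainty_le_norm (S : H →ₗ.[ℂ] H) {φ : S.domain} (hφ : ‖(φ : H)‖ = 1) (t : ℝ) :
    S.uncertainty φ ≤ ‖S φ - (t : ℂ) • (φ : H)‖ := by
  rw [S.uncertainty_eq_norm hφ]
  refine le_of_sq_le_sq ?_ (norm_nonneg _)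
  rw [S.norm_apply_sub_smul_sq hφ, S.norm_apply_sub_smul_sq hφ]
  nlinarith [sq_nonneg (t - S.expectation φ)]

theorem minUncertaintyAt_le (S : H →ₗ.[ℂ] H) {φ : S.domain} (hφ : ‖(φ : H)‖ = 1) :
    S.minUncertaintyAt (S.expectation φ) ≤ ENNReal.ofReal (S.uncertainty φ) :=
  iInf₂_le_of_le φ hφ (iInf_le _ rfl)

theorem minUncertainty_le (S : H →ₗ.[ℂ] H) {φ : S.domain} (hφ : ‖(φ : H)‖ = 1) :
    S.minUncertainty ≤ ENNReal.ofReal (S.uncertainty φ) :=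
  (iInf_le _ _).trans (S.minUncertaintyAt_le hφ)

theorem expectation_of_le {S T : H →ₗ.[ℂ] H} (h : S ≤ T) (φ : S.domain) :
    T.expectation ⟨φ, h.1 φ.2⟩ = S.expectation φ := by
  rw [expectation, expectation, show T ⟨φ, h.1 φ.2⟩ = S φ from (h.2 rfl).symm]

theorem uncertainty_of_le {S T : H →ₗ.[ℂ] H} (h : S ≤ T) (φ : S.domain) :
    T.uncertainty ⟨φ, h.1 φ.2⟩ = S.uncertainty φ := by
  rw [uncertainty, uncertainty, expectation_of_le h,
    show T ⟨φ, h.1 φ.2⟩ = S φ from (h.2 rfl).symm]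

/-- An extension has a smaller minimum uncertainty. -/
theorem minUncertaintyAt_anti {S T : H →ₗ.[ℂ] H} (h : S ≤ T) (t : ℝ) :
    T.minUncertaintyAt t ≤ S.minUncertaintyAt t := by
  refine le_iInf₂ fun φ hφ => le_iInf fun hφt => ?_
  rw [← uncertainty_of_le h, ← hφt, ← expectation_of_le h]
  exact T.minUncertaintyAt_le hφ

theorem mul_norm_le_of_forall_unit (S : H →ₗ.[ℂ] H) {c t : ℝ}
    (h : ∀ φ : S.domain, ‖(φ : H)‖ = 1 → c ≤ ‖S φ - (t : ℂ) • (φ : H)‖) (φ : S.domain) :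
    c * ‖(φ : H)‖ ≤ ‖S φ - (t : ℂ) • (φ : H)‖ := by
  rcases eq_or_ne (φ : H) 0 with h0 | h0
  · rw [h0, norm_zero, mul_zero]
    exact norm_nonneg _
  have hpos : 0 < ‖(φ : H)‖ := norm_pos_iff.2 h0
  have h1 := h (((‖(φ : H)‖⁻¹ : ℝ) : ℂ) • φ) (by
    rw [Submodule.coe_smul, norm_smul, Complex.norm_real, norm_inv, norm_norm,
      inv_mul_cancel₀ hpos.ne'])
  rwa [S.map_smul, Submodule.coe_smul, smul_comm (t : ℂ), ← smul_sub, norm_smul,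
    Complex.norm_real, norm_inv, norm_norm, inv_mul_eq_div, le_div_iff₀ hpos] at h1

/-- A lower bound for the uncertainty is a lower bound for `S - t`. -/
theorem mul_norm_le_of_le_minUncertainty {S : H →ₗ.[ℂ] H} {c : ℝ}
    (h : ENNReal.ofReal c ≤ S.minUncertainty) (t : ℝ) (φ : S.domain) :
    c * ‖(φ : H)‖ ≤ ‖S φ - (t : ℂ) • (φ : H)‖ :=
  S.mul_norm_le_of_forall_unit (fun _ hψ =>
    ((ENNReal.ofReal_le_ofReal_iff (Real.sqrt_nonneg _)).1
      (h.trans (S.minUncertainty_le hψ))).trans (S.uncertainty_le_norm hψ t)) φ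

theorem exists_norm_eq_one [Nontrivial H] {S : H →ₗ.[ℂ] H} (hdense : Dense (S.domain : Set H)) :
    ∃ φ : S.domain, ‖(φ : H)‖ = 1 := by
  obtain ⟨x, hx⟩ := exists_ne (0 : H)
  obtain ⟨φ, hφ, hφ0⟩ : ∃ φ ∈ S.domain, φ ≠ 0 := by
    by_contra! h
    refine hx (hdense.eq_zero_of_inner_left ℂ fun φ hφ => ?_)
    rw [h φ hφ, inner_zero_right]
  refine ⟨((‖φ‖⁻¹ : ℝ) : ℂ) • ⟨φ, hφ⟩, ?_⟩
  rw [Submodule.coe_smul, norm_smul, Complex.norm_real, norm_inv, norm_norm,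
    inv_mul_cancel₀ (norm_ne_zero_iff.2 hφ0)]

theorem IsResolventAt.le_minUncertaintyAt {T : H →ₗ.[ℂ] H} {t : ℝ} {B : H →L[ℂ] H}
    (h : T.IsResolventAt t B) {c : ℝ} (hc : 0 < c) (hB : ‖B‖ ≤ c⁻¹) :
    ENNReal.ofReal c ≤ T.minUncertaintyAt t := by
  refine le_iInf₂ fun φ hφ => le_iInf fun hφt => ENNReal.ofReal_le_ofReal ?_
  rw [T.uncertainty_eq_norm hφ, hφt]
  have h1 := h.norm_le φ
  rw [hφ] at h1
  have h2 : 1 ≤ c⁻¹ * ‖T φ - (t : ℂ) • (φ : H)‖ := h1.trans (by gcongr)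
  rwa [inv_mul_eq_div, one_le_div hc] at h2

/-- Both spectral points may be taken equal, so `spectralMin` is really the distance from `t` to the
spectrum. -/
theorem spectralMin_le_of_mem {T : H →ₗ.[ℂ] H} {t : ℝ} {l : ℂ} (hl : l ∈ T.opSpectrum) :
    T.spectralMin t ≤ ENNReal.ofReal ‖l - t‖ := by
  refine iInf₂_le_of_le l hl (iInf₂_le_of_le l hl ?_)
  rw [Real.sqrt_mul_self (norm_nonneg _)]

theorem spectralMin_le_spectralMinDistinct (T : H →ₗ.[ℂ] H) (t : ℝ) :
    T.spectralMin t ≤ T.spectralMinDistinct t :=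
  le_iInf₂ fun l hl => le_iInf₂ fun m hm => le_iInf fun _ =>
    iInf₂_le_of_le l hl (iInf₂_le_of_le m hm le_rfl)

/-! ### Spectral estimates for self-adjoint operators -/

variable [CompleteSpace H]

theorem IsResolventAt.le_spectralMin {T : H →ₗ.[ℂ] H} {t : ℝ} {B : H →L[ℂ] H}
    (h : T.IsResolventAt t B) {c : ℝ} (hc : 0 < c) (hB : ‖B‖ ≤ c⁻¹) :
    ENNReal.ofReal c ≤ T.spectralMin t := by
  refine le_iInf₂ fun l hl => le_iInf₂ fun m hm => ENNReal.ofReal_le_ofReal ?_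
  refine Real.le_sqrt_of_sq_le ?_
  rw [sq]
  exact mul_le_mul (h.le_norm_sub hc hB hl) (h.le_norm_sub hc hB hm) hc.le (norm_nonneg _)

/-- The distance from `t` to the spectrum of a self-adjoint operator is attained. -/
theorem exists_spectralMin_eq [Nontrivial H] {T : H →ₗ.[ℂ] H} (hT : IsSelfAdjoint T) (t : ℝ) :
    ∃ l ∈ T.opSpectrum, T.spectralMin t = ENNReal.ofReal ‖l - t‖ := by
  by_cases ht : (t : ℂ) ∈ T.opSpectrum
  · refine ⟨t, ht, le_antisymm (spectralMin_le_of_mem ht) ?_⟩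
    simp
  · rw [mem_opSpectrum_iff, not_not] at ht
    obtain ⟨B, hR⟩ := ht
    obtain ⟨l, hl, hlt⟩ := hR.exists_mem_opSpectrum_norm_sub_eq
      (hR.isSelfAdjoint (isFormalAdjoint_of_isSelfAdjoint hT))
    refine ⟨l, hl, le_antisymm (spectralMin_le_of_mem hl) ?_⟩
    have hpos : 0 < ‖l - t‖ := by
      rw [norm_pos_iff, sub_ne_zero]
      rintro rfl
      exact hl ⟨B, hR⟩
    exact hR.le_spectralMin hpos (by rw [hlt, inv_inv])

/-- The distance from `t` to the spectrum of a self-adjoint `T` is a lower bound for `T - t`. -/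
theorem spectralMin_le_norm [Nontrivial H] {T : H →ₗ.[ℂ] H} (hT : IsSelfAdjoint T)
    {φ : T.domain} (hφ : ‖(φ : H)‖ = 1) (t : ℝ) :
    T.spectralMin t ≤ ENNReal.ofReal ‖T φ - (t : ℂ) • (φ : H)‖ := by
  by_cases ht : (t : ℂ) ∈ T.opSpectrum
  · refine (spectralMin_le_of_mem ht).trans ?_
    simp
  · rw [mem_opSpectrum_iff, not_not] at ht
    obtain ⟨B, hR⟩ := ht
    obtain ⟨l, hl, hlt⟩ := hR.exists_mem_opSpectrum_norm_sub_eq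
      (hR.isSelfAdjoint (isFormalAdjoint_of_isSelfAdjoint hT))
    refine (spectralMin_le_of_mem hl).trans (ENNReal.ofReal_le_ofReal ?_)
    have h1 := hR.norm_le φ
    rw [hφ] at h1
    rw [hlt]
    have hB : 0 < ‖B‖ := by
      by_contra hB
      rw [not_lt] at hB
      nlinarith [norm_nonneg (T φ - (t : ℂ) • (φ : H))]
    rwa [inv_le_iff_one_le_mul₀' hB]

/-- A self-adjoint operator whose spectrum is a single real point is a multiple of the identity. -/
theorem apply_eq_smul_of_opSpectrum_subset_singleton {T : H →ₗ.[ℂ] H} (hT : IsSelfAdjoint T)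
    {t : ℝ} (h : T.opSpectrum ⊆ {(t : ℂ)}) (φ : T.domain) : T φ = (t : ℂ) • (φ : H) := by
  have hs : ((t + 1 : ℝ) : ℂ) ∉ T.opSpectrum := fun hs => by
    have := h hs
    simp at this
  rw [mem_opSpectrum_iff, not_not] at hs
  obtain ⟨B, hR⟩ := hs
  have hB := hR.isSelfAdjoint (isFormalAdjoint_of_isSelfAdjoint hT)
  -- A nonzero `k` comes from the spectral point `t + 1 + k⁻¹ = t`, so `k = -1`. The value `0` need
  -- not be excluded here: injectivity of `B` later cancels the factor `B`.
  have hspec : ∀ k ∈ spectrum ℝ B, k * (k + 1) = 0 := by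
    intro k hk
    by_cases hk0 : k = 0
    · rw [hk0, zero_mul]
    have hk1 : (k : ℂ) ∈ spectrum ℂ B := (spectrum.algebraMap_mem_iff ℂ).2 hk
    have hkc : (k : ℂ) ≠ 0 := by exact_mod_cast hk0
    have h1 : ((t + 1 : ℝ) : ℂ) + (k : ℂ)⁻¹ ∈ T.opSpectrum := by
      rw [hR.mem_opSpectrum_iff_mem_spectrum (by simpa using hk0)]
      simpa using hk1
    have h2 : ((t + 1 : ℝ) : ℂ) + (k : ℂ)⁻¹ = t := h h1
    have h3 : (t + 1) + k⁻¹ = t := by exact_mod_cast h2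
    have h4 : k⁻¹ = -1 := by linarith
    have h5 : k = -1 := by rw [← inv_inv k, h4]; norm_num
    rw [h5]; norm_num
  have hBB : B * (B + 1) = 0 := by
    have h1 : cfc (fun k : ℝ => k * (k + 1)) B = cfc (fun _ : ℝ => (0 : ℝ)) B :=
      cfc_congr hspec
    rw [cfc_const_zero, cfc_mul (fun k : ℝ => k) (fun k : ℝ => k + 1) B,
      cfc_add B (fun k : ℝ => k) (fun _ : ℝ => (1 : ℝ)), cfc_id' ℝ B, cfc_const_one ℝ B] at h1
    exact h1
  have h1 : B φ + φ = 0 := hR.injective (by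
    rw [_root_.map_zero]
    exact DFunLike.congr_fun hBB (φ : H))
  have h2 : T φ - ((t + 1 : ℝ) : ℂ) • (φ : H) = -φ := hR.injective (by
    rw [hR.2 φ, _root_.map_neg]
    exact (neg_eq_of_add_eq_zero_right h1).symm)
  rw [sub_eq_iff_eq_add] at h2
  rw [h2]
  push_cast
  module

/-- The variance of a self-adjoint operator in a state of mean `t` is at least
`|l - t| |m - t|` for suitable distinct points `l`, `m` of the spectrum. -/
theorem spectralMinDistinct_le_uncertainty {T : H →ₗ.[ℂ] H} (hT : IsSelfAdjoint T)
    {φ : T.domain} (hφ : ‖(φ : H)‖ = 1) (hpos : 0 < T.uncertainty φ) :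
    T.spectralMinDistinct (T.expectation φ) ≤ ENNReal.ofReal (T.uncertainty φ) := by
  have hu := T.uncertainty_eq_norm hφ
  set t := T.expectation φ with ht
  have hsymm := isFormalAdjoint_of_isSelfAdjoint hT
  by_cases hts : (t : ℂ) ∈ T.opSpectrum
  · obtain ⟨z, hz, hzt⟩ : ∃ z ∈ T.opSpectrum, z ≠ t := by
      by_contra! hcon
      have := apply_eq_smul_of_opSpectrum_subset_singleton hT (t := t) (fun z hz => hcon z hz) φ
      rw [hu, this, sub_self, norm_zero] at hpos
      exact lt_irrefl _ hpos
    refine (iInf₂_le_of_le _ hts (iInf₂_le_of_le z hz (iInf_le _ hzt.symm))).trans ?_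
    simp
  rw [mem_opSpectrum_iff, not_not] at hts
  obtain ⟨B, hR⟩ := hts
  have hB := hR.isSelfAdjoint hsymm
  have : Nontrivial H := ⟨φ, 0, fun h0 => by simp [h0] at hφ⟩
  have hne : (spectrum ℝ B).Nonempty := ContinuousFunctionalCalculus.spectrum_nonempty B hB
  have hcomp : IsCompact (spectrum ℝ B) := ContinuousFunctionalCalculus.isCompact_spectrum B
  obtain ⟨a, ha⟩ := hcomp.exists_isLeast hne
  obtain ⟨b, hb⟩ := hcomp.exists_isGreatest hne
  set ψ := T φ - (t : ℂ) • (φ : H) with hψ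
  have hBψ : B ψ = φ := hR.2 φ
  have h0 : (inner ℂ ψ (B ψ)).re = 0 := by
    have h1 : (inner ℂ (T φ) (φ : H)).re = t := by rw [hsymm φ φ]; rfl
    rw [hBψ, hψ, inner_sub_left, inner_smul_left, Complex.sub_re, h1,
      inner_self_eq_norm_sq_to_K, hφ]
    simp
  have hab := ContinuousLinearMap.norm_sq_le_of_spectrum_subset_Icc hB
    (fun r hr => ⟨ha.2 hr, hb.2 hr⟩) ψ
  rw [h0, hBψ, hφ, ← hu] at hab
  -- `hab` now reads `1 ≤ -a b u²`, with `u` the uncertainty.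
  have hab0 : a * b < 0 := by
    by_contra hcon
    rw [not_lt] at hcon
    nlinarith [mul_nonneg hcon (sq_nonneg (T.uncertainty φ))]
  have ha0 : a ≠ 0 := fun h => by simp [h] at hab0
  have hb0 : b ≠ 0 := fun h => by simp [h] at hab0
  have hmem : ∀ k ∈ spectrum ℝ B, k ≠ 0 → (t : ℂ) + (k : ℂ)⁻¹ ∈ T.opSpectrum := by
    intro k hk hk0
    rw [hR.mem_opSpectrum_iff_mem_spectrum (by simpa using hk0)]
    have hk1 : (k : ℂ) ∈ spectrum ℂ B := (spectrum.algebraMap_mem_iff ℂ).2 hk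
    simpa using hk1
  have hne' : (t : ℂ) + (a : ℂ)⁻¹ ≠ t + (b : ℂ)⁻¹ := by
    intro h
    rw [add_right_inj, inv_inj, Complex.ofReal_inj] at h
    rw [h] at hab0
    exact absurd hab0 (not_lt.2 (mul_self_nonneg b))
  refine (iInf₂_le_of_le _ (hmem a ha.1 ha0) (iInf₂_le_of_le _ (hmem b hb.1 hb0)
    (iInf_le _ hne'))).trans (ENNReal.ofReal_le_ofReal ?_)
  rw [add_sub_cancel_left, add_sub_cancel_left, ← norm_mul, ← mul_inv, ← Complex.ofReal_mul,
    norm_inv, Complex.norm_real, Real.norm_of_nonpos hab0.le]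
  refine Real.sqrt_le_iff.2 ⟨hpos.le, ?_⟩
  rw [inv_le_iff_one_le_mul₀' (neg_pos.2 hab0)]
  linarith

end LinearPMap

/-! ### Extremal extensions and the minimax formulas -/

namespace LinearPMap

variable {H : Type*} [NormedAddCommGroup H] [InnerProductSpace ℂ H] [CompleteSpace H]

/-- This excludes the zero space, where spectra are empty and no minimum is attained. -/
theorem HasDeficiencyIndices.nontrivial {S : H →ₗ.[ℂ] H} {p q : ℕ∞}
    (h : S.HasDeficiencyIndices p q) (hp : p ≠ 0) : Nontrivial H := by
  by_contra hn
  rw [not_nontrivial_iff_subsingleton] at hn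
  refine hp ?_
  rw [← h.1, deficiencyIndex, rank_subsingleton', _root_.map_zero]

/-- A lower bound `c > 0` for the uncertainty of `S` is attained by a self-adjoint extension at
every `t`. -/
theorem exists_selfAdjointExtension_ofReal_le {S : H →ₗ.[ℂ] H}
    (hdense : Dense (S.domain : Set H)) (hsymm : S.IsFormalAdjoint S) (t : ℝ) {c : ℝ} (hc : 0 < c)
    (h : ∀ φ : S.domain, c * ‖(φ : H)‖ ≤ ‖S φ - (t : ℂ) • (φ : H)‖) :
    ∃ T ∈ S.selfAdjointExtensions,
      ENNReal.ofReal c ≤ T.minUncertaintyAt t ∧ ENNReal.ofReal c ≤ T.spectralMin t := by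
  obtain ⟨T, hT, B, hR, -, hB⟩ :=
    exists_selfAdjointExtension_isResolventAt hdense hsymm t hc h
  exact ⟨T, hT, hR.le_minUncertaintyAt hc hB, hR.le_spectralMin hc hB⟩

/-- Every symmetric operator of positive minimum uncertainty has, for every `t`, a self-adjoint
extension whose uncertainty at `t` is no smaller. -/
theorem exists_selfAdjointExtension_minUncertainty_le {S : H →ₗ.[ℂ] H}
    (hdense : Dense (S.domain : Set H)) (hsymm : S.IsFormalAdjoint S)
    (hpos : 0 < S.minUncertainty) (t : ℝ) :
    ∃ T ∈ S.selfAdjointExtensions,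
      S.minUncertainty ≤ T.minUncertaintyAt t ∧ S.minUncertainty ≤ T.spectralMin t := by
  rcases eq_or_ne S.minUncertainty ⊤ with htop | htop
  · have hsub : Subsingleton H := by
      rw [← not_nontrivial_iff_subsingleton]
      intro hn
      obtain ⟨φ, hφ⟩ := exists_norm_eq_one hdense
      exact absurd (S.minUncertainty_le hφ) (by simp [htop])
    obtain ⟨T, hT, B, hR, -, hB⟩ :=
      exists_selfAdjointExtension_isResolventAt hdense hsymm t one_pos fun φ => by
        rw [Subsingleton.elim (φ : H) 0]
        simp
    refine ⟨T, hT, le_iInf₂ fun φ hφ => ?_, le_iInf₂ fun l hl => ?_⟩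
    · rw [Subsingleton.elim (φ : H) 0, norm_zero] at hφ
      exact absurd hφ zero_ne_one
    · exact absurd ⟨0, fun _ => ⟨T.domain.zero_mem, Subsingleton.elim _ _⟩,
        fun _ => Subsingleton.elim _ _⟩ hl
  · have hc : 0 < S.minUncertainty.toReal := ENNReal.toReal_pos hpos.ne' htop
    have hof := ENNReal.ofReal_toReal htop
    have := exists_selfAdjointExtension_ofReal_le hdense hsymm t hc
      (mul_norm_le_of_le_minUncertainty hof.le t)
    rwa [hof] at this

/-- Some self-adjoint extension maximizes the distance from `t` to the spectrum. -/
theorem exists_selfAdjointExtension_forall_spectralMin_le [Nontrivial H] {S : H →ₗ.[ℂ] H}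
    (hdense : Dense (S.domain : Set H)) (hsymm : S.IsFormalAdjoint S)
    (hpos : 0 < S.minUncertainty) (t : ℝ) :
    ∃ T ∈ S.selfAdjointExtensions, ∀ T' ∈ S.selfAdjointExtensions,
      T'.spectralMin t ≤ T.spectralMin t := by
  -- The optimal lower bound of `S - t`: Krein's extension reaches it, and every extension, agreeing
  -- with `S` on its domain, is limited by it.
  set m : ℝ≥0∞ := ⨅ (φ : S.domain) (_ : ‖(φ : H)‖ = 1),
    ENNReal.ofReal ‖S φ - (t : ℂ) • (φ : H)‖ with hm
  have hm_le : ∀ φ : S.domain, ‖(φ : H)‖ = 1 → m ≤ ENNReal.ofReal ‖S φ - (t : ℂ) • (φ : H)‖ :=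
    fun φ hφ => iInf₂_le φ hφ
  have hmin : S.minUncertainty ≤ m := le_iInf₂ fun φ hφ =>
    (S.minUncertainty_le hφ).trans (ENNReal.ofReal_le_ofReal (S.uncertainty_le_norm hφ t))
  obtain ⟨φ₀, hφ₀⟩ := exists_norm_eq_one hdense
  have htop : m ≠ ⊤ := ne_top_of_le_ne_top ENNReal.ofReal_ne_top (hm_le φ₀ hφ₀)
  have hof := ENNReal.ofReal_toReal htop
  have hc : 0 < m.toReal := ENNReal.toReal_pos (hpos.trans_le hmin).ne' htop
  obtain ⟨T, hT, -, hTm⟩ := exists_selfAdjointExtension_ofReal_le hdense hsymm t hc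
    (S.mul_norm_le_of_forall_unit fun φ hφ =>
      (ENNReal.ofReal_le_ofReal_iff (norm_nonneg _)).1 (hof.le.trans (hm_le φ hφ)))
  refine ⟨T, hT, fun T' hT' => le_trans (le_iInf₂ fun φ hφ => ?_) (hof.ge.trans hTm)⟩
  rw [show S φ = T' ⟨φ, hT'.1.1 φ.2⟩ from hT'.1.2 rfl]
  exact spectralMin_le_norm hT'.2 (φ := ⟨φ, hT'.1.1 φ.2⟩) hφ t

theorem spectralMinDistinct_le_minUncertaintyAt {S T : H →ₗ.[ℂ] H}
    (hT : T ∈ S.selfAdjointExtensions) (hpos : 0 < S.minUncertainty) (t : ℝ) :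
    T.spectralMinDistinct t ≤ S.minUncertaintyAt t := by
  refine le_iInf₂ fun φ hφ => le_iInf fun hφt => ?_
  rw [← uncertainty_of_le hT.1, ← hφt, ← expectation_of_le hT.1]
  refine spectralMinDistinct_le_uncertainty hT.2 hφ ?_
  rw [uncertainty_of_le hT.1]
  exact ENNReal.ofReal_pos.1 (hpos.trans_le (S.minUncertainty_le hφ))

end LinearPMap

theorem corollary2 {H : Type*} [NormedAddCommGroup H] [InnerProductSpace ℂ H] [CompleteSpace H]
    [TopologicalSpace.SeparableSpace H]
    (S : H →ₗ.[ℂ] H) (hdense : Dense (S.domain : Set H)) (hclosed : S.IsClosed)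
    (hsymm : S.IsFormalAdjoint S)
    (n : ℕ∞) (hn : S.HasDeficiencyIndices n n) (hpos : 0 < S.minUncertainty) :
    (∀ t : ℝ, ∃ T ∈ S.selfAdjointExtensions,
      S.minUncertainty / ENNReal.ofReal √2 ≤ T.minUncertaintyAt t) ∧
    (n = 1 →
      (∀ t : ℝ, ∃ T ∈ S.selfAdjointExtensions, S.minUncertainty ≤ T.minUncertaintyAt t) ∧
      (S.minUncertainty = ⨅ t : ℝ, ⨆ T ∈ S.selfAdjointExtensions, T.minUncertaintyAt t) ∧
      -- the minimum over the spectrum and the maximum over the extensions are attained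
      (∀ t : ℝ, ∀ T ∈ S.selfAdjointExtensions, ∃ l ∈ T.opSpectrum, ∃ m ∈ T.opSpectrum,
        T.spectralMin t = ENNReal.ofReal √(‖l - t‖ * ‖m - t‖)) ∧
      (∀ t : ℝ, ∃ T ∈ S.selfAdjointExtensions, ∀ T' ∈ S.selfAdjointExtensions,
        T'.spectralMin t ≤ T.spectralMin t) ∧
      (S.minUncertainty = ⨅ t : ℝ, ⨆ T ∈ S.selfAdjointExtensions, T.spectralMin t) ∧
      (S.minUncertainty = ⨅ t : ℝ, ⨆ T ∈ S.selfAdjointExtensions, T.spectralMinDistinct t)) := by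
  have hext := LinearPMap.exists_selfAdjointExtension_minUncertainty_le hdense hsymm hpos
  -- All three formulas come from one sandwich: some extension reaches `ΔS`, none exceeds `ΔS_t`.
  have hminimax : ∀ f : (H →ₗ.[ℂ] H) → ℝ → ℝ≥0∞,
      (∀ t, ∃ T ∈ S.selfAdjointExtensions, S.minUncertainty ≤ f T t) →
      (∀ t, ∀ T ∈ S.selfAdjointExtensions, f T t ≤ S.minUncertaintyAt t) →
      S.minUncertainty = ⨅ t : ℝ, ⨆ T ∈ S.selfAdjointExtensions, f T t := by
    intro f h1 h2
    refine le_antisymm (le_iInf fun t => ?_) (iInf_mono fun t => iSup₂_le (h2 t))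
    obtain ⟨T, hT, hle⟩ := h1 t
    exact le_iSup₂_of_le T hT hle
  refine ⟨fun t => ?_, fun hn1 => ?_⟩
  · obtain ⟨T, hT, hle, -⟩ := hext t
    -- Dividing by `√2 ≥ 1` only weakens the bound.
    refine ⟨T, hT, (ENNReal.div_le_of_le_mul ?_).trans hle⟩
    refine le_mul_of_one_le_right zero_le ?_
    rw [ENNReal.one_le_ofReal, Real.one_le_sqrt]
    norm_num
  have : Nontrivial H := hn.nontrivial (by rw [hn1]; exact one_ne_zero)
  refine ⟨fun t => ?_, ?_, fun t T hT => ?_, fun t => ?_, ?_, ?_⟩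
  · obtain ⟨T, hT, hle, -⟩ := hext t
    exact ⟨T, hT, hle⟩
  · refine hminimax (fun T t => T.minUncertaintyAt t) (fun t => ?_)
      fun t T hT => LinearPMap.minUncertaintyAt_anti hT.1 t
    obtain ⟨T, hT, hle, -⟩ := hext t
    exact ⟨T, hT, hle⟩
  · obtain ⟨l, hl, hlt⟩ := LinearPMap.exists_spectralMin_eq hT.2 t
    exact ⟨l, hl, l, hl, by rw [hlt, Real.sqrt_mul_self (norm_nonneg _)]⟩
  · exact LinearPMap.exists_selfAdjointExtension_forall_spectralMin_le hdense hsymm hpos t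
  · refine hminimax (fun T t => T.spectralMin t) (fun t => ?_)
      fun t T hT => (T.spectralMin_le_spectralMinDistinct t).trans
        (LinearPMap.spectralMinDistinct_le_minUncertaintyAt hT hpos t)
    obtain ⟨T, hT, -, hle⟩ := hext t
    exact ⟨T, hT, hle⟩
  · refine hminimax (fun T t => T.spectralMinDistinct t) (fun t => ?_)
      fun t T hT => LinearPMap.spectralMinDistinct_le_minUncertaintyAt hT hpos t
    obtain ⟨T, hT, -, hle⟩ := hext t
    exact ⟨T, hT, hle.trans (T.spectralMin_le_spectralMinDistinct t)⟩
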